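/- For a finite simple graph \(G\), let \(\rho(G)\) denote the largest eigenvalue of its adjacency matrix. A Hamilton path of \(G\) is a path that visits every vertex of \(G\) exactly once. Let \(G\) be a connected graph on \(n \ge 7\) vertices. If \(\rho(G) \ge \sqrt{(n-3)^2+2}\), then \(G\) contains a Hamilton path. Moreover, the hypothesis \(n\ge 7\) cannot be relaxed to \(n \ge 5\): let \(K_2\vee 4K_1\) be the graph on \(n=6\) vertices obtained from the complete graph \(K_2\) and four isolated vertices by joining each vertex of \(K_2\) to each of the four isolated vertices. It is connected and satisfies \(\rho(K_2\vee 4K_1) > \sqrt{(6-3)^2+2}\), but it contains no Hamilton path. -/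

import Mathlib

/-- The spectral radius of a finite simple graph: the largest (real) eigenvalue of its
adjacency matrix. -/
noncomputable def SimpleGraph.rho {V : Type*} [Fintype V] [DecidableEq V]
    (G : SimpleGraph V) [DecidableRel G.Adj] : ℝ :=
  sSup {μ : ℝ | Module.End.HasEigenvalue (Matrix.toLin' (G.adjMatrix ℝ)) μ}

/-- On a nonempty vertex set the supremum is attained, so `G.rho` really is the largest eigenvalue
of the adjacency matrix. -/
theorem SimpleGraph.isGreatest_rho {V : Type*} [Fintype V] [DecidableEq V] [Nonempty V]
    (G : SimpleGraph V) [DecidableRel G.Adj] :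
    IsGreatest {μ : ℝ | Module.End.HasEigenvalue (Matrix.toLin' (G.adjMatrix ℝ)) μ} G.rho := by
  have hfin : {μ : ℝ | Module.End.HasEigenvalue (Matrix.toLin' (G.adjMatrix ℝ)) μ}.Finite :=
    Module.End.finite_hasEigenvalue _
  have hA : (G.adjMatrix ℝ).IsHermitian := by
    rw [Matrix.IsHermitian, Matrix.conjTranspose_eq_transpose_of_trivial]
    exact G.transpose_adjMatrix
  have hne : {μ : ℝ | Module.End.HasEigenvalue (Matrix.toLin' (G.adjMatrix ℝ)) μ}.Nonempty := by
    obtain ⟨i⟩ := (inferInstance : Nonempty V)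
    refine ⟨hA.eigenvalues i, ?_⟩
    have h := hA.eigenvalues_mem_spectrum_real i
    rw [← Matrix.spectrum_toLin'] at h
    exact Module.End.hasEigenvalue_iff_mem_spectrum.mpr h
  exact ⟨hne.csSup_mem hfin, fun _ h => le_csSup hfin.bddAbove h⟩

/-- `G` contains a Hamilton path: a walk that visits every vertex exactly once. -/
def SimpleGraph.HasHamiltonPath {V : Type*} [DecidableEq V] (G : SimpleGraph V) : Prop :=
  ∃ (u v : V) (p : G.Walk u v), p.IsHamiltonian

/-- The join `G ∨ H` of two disjoint graphs: the disjoint union of `G` and `H` together with all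
edges between a vertex of `G` and a vertex of `H`. -/
def SimpleGraph.graphJoin {V W : Type*} (G : SimpleGraph V) (H : SimpleGraph W) :
    SimpleGraph (V ⊕ W) :=
  (G ⊕g H) ⊔ completeBipartiteGraph V W

instance {V W : Type*} (G : SimpleGraph V) (H : SimpleGraph W) [DecidableRel G.Adj]
    [DecidableRel H.Adj] : DecidableRel (G.graphJoin H).Adj
  | .inl a, .inl b => decidable_of_iff (G.Adj a b) (by simp [SimpleGraph.graphJoin])
  | .inr a, .inr b => decidable_of_iff (H.Adj a b) (by simp [SimpleGraph.graphJoin])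
  | .inl _, .inr _ => isTrue (by simp [SimpleGraph.graphJoin])
  | .inr _, .inl _ => isTrue (by simp [SimpleGraph.graphJoin])

/-- The graph `K₂ ∨ 4K₁` on six vertices. -/
abbrev K2Join4K1 : SimpleGraph (Fin 2 ⊕ Fin 4) :=
  (⊤ : SimpleGraph (Fin 2)).graphJoin (⊥ : SimpleGraph (Fin 4))

/-! Suppose `G` is connected without a Hamilton path. In an edge-maximal supergraph `H` without one,
non-adjacent vertices have degree sum at most n - 2 (Ore's crossing argument). A non-adjacent pair
of largest degree sum then yields an s with at least s + 1 vertices of degree at most s and at least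
n - s of degree at most n - s - 2 (`exists_card_degree_le_of_not_hasHamiltonPath`). These counts
alone bound the spectral radius. Give weights c ≤ b ≤ a to the low, middle and high degree vertices;
the Collatz–Wielandt inequality then reduces to three scalar inequalities
(`rho_le_of_card_degree_le`). Explicit weights give a bound below √((n-3)² + 2), with s = 1 and s ≥
2 treated separately. In K₂ ∨ 4K₁ the independent vertices are too many to be separated along a
path, and an explicit eigenvector bounds ρ from below. -/

/-! ### Hamilton paths as lists, and counting along lists. -/

theorem SimpleGraph.hasHamiltonPath_iff_exists_list {V : Type*} [DecidableEq V] [Nonempty V]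
    {G : SimpleGraph V} :
    G.HasHamiltonPath ↔ ∃ l : List V, l.IsChain G.Adj ∧ ∀ a, l.count a = 1 := by
  constructor
  · rintro ⟨u, v, p, hp⟩
    exact ⟨p.support, p.isChain_adj_support, hp⟩
  · rintro ⟨l, hl, hc⟩
    have hne : l ≠ [] := by
      rintro rfl
      obtain ⟨a⟩ := ‹Nonempty V›
      simpa using hc a
    refine ⟨_, _, SimpleGraph.Walk.ofSupport l hne hl, fun a => ?_⟩
    rw [SimpleGraph.Walk.support_ofSupport]
    exact hc a

theorem List.nodup_of_count_eq_one {V : Type*} [DecidableEq V] {l : List V}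
    (h : ∀ a, l.count a = 1) : l.Nodup :=
  List.nodup_iff_count_le_one.2 fun a => (h a).le

theorem List.countP_eq_card_filter_univ {V : Type*} [Fintype V] [DecidableEq V] {l : List V}
    (h : ∀ a, l.count a = 1) (f : V → Bool) :
    l.countP f = (Finset.univ.filter fun a => f a = true).card := by
  have hn : (l.filter f).Nodup := (List.nodup_of_count_eq_one h).filter _
  have hmem : ∀ a, a ∈ l := fun a => List.count_pos_iff.1 (by simp [h a])
  rw [List.countP_eq_length_filter, ← List.toFinset_card_of_nodup hn]
  congr 1
  ext a
  simp [hmem]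

theorem SimpleGraph.degree_eq_countP {V : Type*} [Fintype V] [DecidableEq V]
    (G : SimpleGraph V) [DecidableRel G.Adj] {l : List V} (h : ∀ a, l.count a = 1) (u : V) :
    G.degree u = l.countP (G.Adj u) := by
  rw [List.countP_eq_card_filter_univ h, ← SimpleGraph.card_neighborFinset_eq_degree]
  congr 1
  ext a
  simp

/-- The successors of the `U`-entries all exist, since the last entry is not in `U`, and none is in
`W`. So they and the `W`-entries occupy disjoint positions of the tail. -/
theorem List.IsChain.countP_add_countP_le {V : Type*} {U W : V → Bool} (x : V) (l : List V)
    (h : (x :: l).IsChain fun a b => ¬(U a = true ∧ W b = true))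
    (hlast : U ((x :: l).getLast (by simp)) = false) :
    (x :: l).countP U + l.countP W ≤ l.length := by
  induction l generalizing x with
  | nil => simp_all
  | cons y t ih =>
    rw [List.isChain_cons_cons] at h
    have := ih y h.2 (by simpa using hlast)
    rw [List.countP_cons, List.countP_cons (p := W), List.length_cons]
    have h1 := h.1
    cases hU : U x <;> cases hW : W y <;> simp [hU, hW] at h1 ⊢ <;> omega

theorem List.IsChain.countP_add_countP_lt {V : Type*} {U W : V → Bool} {l : List V} (hl : l ≠ [])
    (h : l.IsChain fun a b => ¬(U a = true ∧ W b = true))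
    (hlast : U (l.getLast hl) = false) (hhead : W (l.head hl) = false) :
    l.countP U + l.countP W < l.length := by
  cases l with
  | nil => simp at hl
  | cons x l =>
    have := List.IsChain.countP_add_countP_le x l h hlast
    rw [List.countP_cons (p := W)]
    simp at hhead
    simp [hhead]
    omega

/-! ### Ore-type and Chvátal-type degree conditions. -/

/-- If two paths of `G`, the first ending in `u` and the second starting in `v`, partition the
vertex set of a graph without Hamilton path, then `u` and `v` have small degree sum. -/
theorem SimpleGraph.degree_add_degree_of_path_partition {V : Type*} [Fintype V] [DecidableEq V]
    {G : SimpleGraph V} [DecidableRel G.Adj] (hG : ¬ G.HasHamiltonPath) {u v : V} {p q : List V}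
    (hp : (p ++ [u]).IsChain G.Adj) (hq : (v :: q).IsChain G.Adj)
    (hc : ∀ a, ((p ++ [u]) ++ v :: q).count a = 1) :
    G.degree u + G.degree v + 2 ≤ Fintype.card V := by
  have : Nonempty V := ⟨u⟩
  have hno : ∀ l : List V, l.Perm ((p ++ [u]) ++ v :: q) → ¬ l.IsChain G.Adj := fun l hl hch =>
    hG (hasHamiltonPath_iff_exists_list.2 ⟨l, hch, fun a => by rw [hl.count_eq, hc a]⟩)
  have hcard : Fintype.card V = ((p ++ [u]) ++ v :: q).length := by
    simpa using (List.countP_eq_card_filter_univ hc fun _ => true).symm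
  have hrev : ∀ l : List V, l.IsChain G.Adj → l.reverse.IsChain G.Adj := fun l hl =>
    List.isChain_reverse.2 (hl.imp fun _ _ h => h.symm)
  -- A consecutive pair x, y on the first path with u ~ x and v ~ y would give the Hamilton path
  -- that runs to x, jumps to u, returns to y and continues from v. The second path is treated
  -- symmetrically.
  have h1 : (p ++ [u]).countP (G.Adj u) + (p ++ [u]).countP (G.Adj v) < (p ++ [u]).length := by
    apply List.IsChain.countP_add_countP_lt (by simp)
    · rw [List.isChain_iff_forall_rel_of_append_cons_cons]
      rintro x y a b hab ⟨hx, hy⟩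
      simp only [decide_eq_true_eq] at hx hy
      rw [hab] at hp
      obtain ⟨h2, h3⟩ := List.isChain_split.1 (by simpa using hp : (a ++ x :: (y :: b)).IsChain G.Adj)
      refine hno ((a ++ [x]) ++ ((y :: b).reverse ++ v :: q)) ?_ ?_
      · rw [hab]
        simp only [List.append_assoc, List.cons_append, List.nil_append]
        refine List.Perm.append_left _ (List.Perm.cons _ ?_)
        exact (List.reverse_perm (y :: b)).append_right _
      · have hlast : (y :: b).getLast? = some u := by
          have := congrArg List.getLast? hab
          rw [List.getLast?_append, List.getLast?_append, List.getLast?_cons_cons] at this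
          rw [List.getLast?_eq_some_getLast (List.cons_ne_nil y b)] at this ⊢
          simpa using this.symm
        refine List.isChain_append.2 ⟨h2, List.isChain_append.2 ⟨hrev _ h3.of_cons, hq, ?_⟩, ?_⟩
        · simp only [List.getLast?_reverse, List.head?_cons, Option.mem_some_iff]
          rintro _ rfl _ rfl
          exact hy.symm
        · rw [List.head?_append, List.head?_reverse, hlast]
          rintro c hc d hd
          simp at hc hd
          subst hc hd
          exact hx.symm
    · simp
    · simp only [decide_eq_false_iff_not]
      intro h
      refine hno ((p ++ [u]).reverse ++ v :: q) ((List.reverse_perm _).append_right _) ?_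
      rw [List.isChain_append]
      refine ⟨hrev _ hp, hq, ?_⟩
      rw [List.getLast?_reverse, List.head?_eq_some_head (by simp)]
      simp only [List.head?_cons, Option.mem_some_iff]
      rintro _ rfl _ rfl
      exact h.symm
  have h2 : (v :: q).countP (G.Adj u) + (v :: q).countP (G.Adj v) < (v :: q).length := by
    apply List.IsChain.countP_add_countP_lt (by simp)
    · rw [List.isChain_iff_forall_rel_of_append_cons_cons]
      rintro x y a b hab ⟨hx, hy⟩
      simp only [decide_eq_true_eq] at hx hy
      rw [hab] at hq
      obtain ⟨h2, h3⟩ := List.isChain_split.1 (by simpa using hq : (a ++ x :: (y :: b)).IsChain G.Adj)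
      refine hno ((p ++ [u]) ++ ((a ++ [x]).reverse ++ (y :: b))) ?_ ?_
      · rw [hab]
        refine List.Perm.append_left _ ?_
        have := (List.reverse_perm (a ++ [x])).append_right (y :: b)
        simpa using this
      · have hhead : (a ++ [x]).head? = some v := by
          have := congrArg List.head? hab
          cases a <;> simp_all
        refine List.isChain_append.2 ⟨hp, List.isChain_append.2 ⟨hrev _ h2, h3.of_cons, ?_⟩, ?_⟩
        · rw [List.getLast?_reverse, hhead]
          simp only [List.head?_cons, Option.mem_some_iff]
          rintro _ rfl _ rfl
          exact hy
        · rintro c hc d hd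
          simp at hc hd
          subst hc hd
          exact hx
    · simp only [decide_eq_false_iff_not]
      intro h
      refine hno ((p ++ [u]) ++ (v :: q).reverse) ((List.reverse_perm _).append_left _) ?_
      rw [List.isChain_append]
      refine ⟨hp, hrev _ hq, ?_⟩
      rw [List.head?_reverse, List.getLast?_eq_some_getLast (List.cons_ne_nil v q)]
      rintro c hc d hd
      simp only [List.getLast?_append, List.getLast?_singleton, Option.some_or,
        Option.mem_some_iff] at hc hd
      subst hc hd
      exact h
    · simp
  rw [G.degree_eq_countP hc u, G.degree_eq_countP hc v, hcard]
  rw [List.countP_append (l₂ := v :: q), List.countP_append (l₂ := v :: q), List.length_append]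
  omega

/-- If `G` has no Hamilton path but `G` with the edge `uv` added has one, then the degrees of `u`
and `v` sum to at most `n - 2`. -/
theorem SimpleGraph.degree_add_degree_of_sup_edge {V : Type*} [Fintype V] [DecidableEq V]
    {G : SimpleGraph V} [DecidableRel G.Adj] (hG : ¬ G.HasHamiltonPath) {u v : V}
    (h : (G ⊔ SimpleGraph.edge u v).HasHamiltonPath) :
    G.degree u + G.degree v + 2 ≤ Fintype.card V := by
  have : Nonempty V := ⟨u⟩
  obtain ⟨l, hl, hc⟩ := hasHamiltonPath_iff_exists_list.1 h
  have hnd := List.nodup_of_count_eq_one hc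
  have hnl : ¬ l.IsChain G.Adj := fun h' => hG (hasHamiltonPath_iff_exists_list.2 ⟨l, h', hc⟩)
  rw [List.isChain_iff_forall_rel_of_append_cons_cons] at hnl
  push Not at hnl
  obtain ⟨x, y, p, q, hpq, hxy⟩ := hnl
  have hadj := (List.isChain_iff_forall_rel_of_append_cons_cons.1 hl) hpq
  subst hpq
  have hxy' : (x = u ∧ y = v) ∨ (x = v ∧ y = u) := by
    rw [SimpleGraph.sup_adj, SimpleGraph.edge_adj] at hadj
    tauto
  obtain ⟨h1, h2⟩ := List.isChain_split.1 hl
  -- Each half misses one end of the added edge, so all its steps are already edges of `G`.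
  have hnd' : ((p ++ [x]) ++ y :: q).Nodup := by simpa using hnd
  have hx : x ∉ y :: q := fun hx => List.disjoint_of_nodup_append hnd' (by simp) hx
  have hy : y ∉ p ++ [x] := fun hy => List.disjoint_of_nodup_append hnd' hy (by simp)
  have h1' : (p ++ [x]).IsChain G.Adj := by
    refine List.IsChain.imp_of_mem_imp (fun a b ha hb hab => ?_) h1
    rw [SimpleGraph.sup_adj, SimpleGraph.edge_adj] at hab
    rcases hab with hab | hab
    · exact hab
    · exfalso
      rcases hxy' with ⟨rfl, rfl⟩ | ⟨rfl, rfl⟩ <;> rcases hab with ⟨⟨rfl, rfl⟩ | ⟨rfl, rfl⟩, _⟩ <;>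
        contradiction
  have h2' : (y :: q).IsChain G.Adj := by
    refine List.IsChain.imp_of_mem_imp (fun a b ha hb hab => ?_) h2.of_cons
    rw [SimpleGraph.sup_adj, SimpleGraph.edge_adj] at hab
    rcases hab with hab | hab
    · exact hab
    · exfalso
      rcases hxy' with ⟨rfl, rfl⟩ | ⟨rfl, rfl⟩ <;> rcases hab with ⟨⟨rfl, rfl⟩ | ⟨rfl, rfl⟩, _⟩ <;>
        contradiction
  have := degree_add_degree_of_path_partition hG h1' h2' (by simpa using hc)
  rcases hxy' with ⟨rfl, rfl⟩ | ⟨rfl, rfl⟩ <;> omega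

theorem SimpleGraph.hasHamiltonPath_top {V : Type*} [Fintype V] [DecidableEq V] [Nonempty V] :
    (⊤ : SimpleGraph V).HasHamiltonPath := by
  refine hasHamiltonPath_iff_exists_list.2 ⟨Finset.univ.toList, ?_, fun a => ?_⟩
  · exact (Finset.nodup_toList _).isChain.imp fun a b h => h
  · exact List.count_eq_one_of_mem (Finset.nodup_toList _) (by simp)

theorem SimpleGraph.exists_maximal_not_hasHamiltonPath {V : Type*} [Fintype V] [DecidableEq V]
    {G : SimpleGraph V} (hG : ¬ G.HasHamiltonPath) :
    ∃ H : SimpleGraph V, G ≤ H ∧ ¬ H.HasHamiltonPath ∧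
      ∀ u v, u ≠ v → ¬ H.Adj u v → (H ⊔ SimpleGraph.edge u v).HasHamiltonPath := by
  obtain ⟨H, hGH, hH⟩ := (Set.toFinite {H : SimpleGraph V | ¬ H.HasHamiltonPath}).exists_le_maximal hG
  refine ⟨H, hGH, hH.1, fun u v huv hadj => ?_⟩
  by_contra hcon
  have hle := hH.2 (y := H ⊔ SimpleGraph.edge u v) hcon le_sup_left
  refine hadj (hle ?_)
  rw [SimpleGraph.sup_adj, SimpleGraph.edge_adj]
  exact Or.inr ⟨Or.inl ⟨rfl, rfl⟩, huv⟩

/-- A degree condition of Chvátal type: a graph without isolated vertices and without Hamilton path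
has many vertices of small degree. -/
theorem SimpleGraph.exists_card_degree_le_of_not_hasHamiltonPath {V : Type*} [Fintype V]
    [DecidableEq V] [Nonempty V] {G : SimpleGraph V} [DecidableRel G.Adj]
    (hG : ¬ G.HasHamiltonPath) (hdeg : ∀ v, 0 < G.degree v) :
    ∃ s : ℕ, 1 ≤ s ∧ 2 * s + 2 ≤ Fintype.card V ∧
      s + 1 ≤ (Finset.univ.filter fun v => G.degree v ≤ s).card ∧
      Fintype.card V ≤ (Finset.univ.filter fun v => G.degree v + s + 2 ≤ Fintype.card V).card + s := by
  classical
  obtain ⟨H, hGH, hH, hmax⟩ := exists_maximal_not_hasHamiltonPath hG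
  have hle : ∀ v, G.degree v ≤ H.degree v := fun v => SimpleGraph.degree_le_of_le hGH
  have hore : ∀ u v, u ≠ v → ¬ H.Adj u v → H.degree u + H.degree v + 2 ≤ Fintype.card V :=
    fun u v huv h => degree_add_degree_of_sup_edge hH (hmax u v huv h)
  let S : Finset (V × V) := Finset.univ.filter fun e => e.1 ≠ e.2 ∧ ¬ H.Adj e.1 e.2 ∧
    H.degree e.1 ≤ H.degree e.2
  have hS : S.Nonempty := by
    by_contra hcon
    rw [Finset.not_nonempty_iff_eq_empty, Finset.filter_eq_empty_iff] at hcon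
    have htop : H = ⊤ := by
      ext a b
      rw [SimpleGraph.top_adj]
      refine ⟨fun h => h.ne, fun hab => ?_⟩
      by_contra h
      rcases le_total (H.degree a) (H.degree b) with h' | h'
      · exact hcon (x := (a, b)) (Finset.mem_univ _) ⟨hab, h, h'⟩
      · exact hcon (x := (b, a)) (Finset.mem_univ _) ⟨hab.symm, fun h'' => h h''.symm, h'⟩
    exact hH (htop ▸ hasHamiltonPath_top)
  obtain ⟨⟨u, v⟩, huv, hbest⟩ := S.exists_max_image (fun e => H.degree e.1 + H.degree e.2) hS
  simp only [S, Finset.mem_filter, Finset.mem_univ, true_and] at huv hbest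
  obtain ⟨hne, hnadj, hdle⟩ := huv
  have hbest' : ∀ a b, a ≠ b → ¬ H.Adj a b →
      H.degree a + H.degree b ≤ H.degree u + H.degree v := by
    intro a b hab h
    rcases le_total (H.degree a) (H.degree b) with h' | h'
    · exact hbest (a, b) ⟨hab, h, h'⟩
    · have := hbest (b, a) ⟨hab.symm, fun h'' => h h''.symm, h'⟩
      simp only at this
      omega
  have hsum := hore u v hne hnadj
  -- s is the smaller degree of the extremal pair. Non-neighbours of v have degree at most s by
  -- extremality; non-neighbours of u, including u itself, have degree at most n - s - 2 by the Ore
  -- bound.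
  refine ⟨H.degree u, (hdeg u).trans_le (hle u), by omega, ?_, ?_⟩
  · have hsub : Finset.univ \ (insert v (H.neighborFinset v)) ⊆
        Finset.univ.filter fun w => G.degree w ≤ H.degree u := by
      intro w hw
      simp only [Finset.mem_sdiff, Finset.mem_univ, true_and, Finset.mem_insert,
        SimpleGraph.mem_neighborFinset, not_or] at hw
      have := hbest' w v hw.1 fun h => hw.2 h.symm
      have := hle w
      simp only [Finset.mem_filter, Finset.mem_univ, true_and]
      omega
    have h1 := Finset.card_le_card hsub
    rw [Finset.card_sdiff_of_subset (Finset.subset_univ _), Finset.card_insert_of_notMem (by simp),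
      SimpleGraph.card_neighborFinset_eq_degree, Finset.card_univ] at h1
    omega
  · have hsub : Finset.univ \ H.neighborFinset u ⊆
        Finset.univ.filter fun w => G.degree w + H.degree u + 2 ≤ Fintype.card V := by
      intro w hw
      simp only [Finset.mem_sdiff, Finset.mem_univ, true_and,
        SimpleGraph.mem_neighborFinset] at hw
      have := hle w
      simp only [Finset.mem_filter, Finset.mem_univ, true_and]
      rcases eq_or_ne w u with rfl | hwu
      · omega
      · have := hore u w hwu.symm hw
        omega
    have h1 := Finset.card_le_card hsub
    rw [Finset.card_sdiff_of_subset (Finset.subset_univ _),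
      SimpleGraph.card_neighborFinset_eq_degree, Finset.card_univ] at h1
    omega

/-! ### Upper bounds for the spectral radius. -/

/-- The Collatz–Wielandt upper bound for the spectral radius. -/
theorem SimpleGraph.rho_le_of_forall_sum_le {V : Type*} [Fintype V] [DecidableEq V] [Nonempty V]
    (G : SimpleGraph V) [DecidableRel G.Adj] {y : V → ℝ} {r : ℝ} (hy : ∀ v, 0 < y v)
    (h : ∀ v, ∑ w ∈ G.neighborFinset v, y w ≤ r * y v) : G.rho ≤ r := by
  obtain ⟨x, hx⟩ := Module.End.HasEigenvalue.exists_hasEigenvector G.isGreatest_rho.1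
  have hx0 : x ≠ 0 := hx.2
  have hxe : ∀ v, ∑ w ∈ G.neighborFinset v, x w = G.rho * x v := by
    intro v
    have := congrFun hx.apply_eq_smul v
    rwa [Matrix.toLin'_apply, SimpleGraph.adjMatrix_mulVec_apply] at this
  -- The eigenvalue equation is compared with `h` at a vertex where |x|/y is largest.
  obtain ⟨p, -, hp⟩ := Finset.univ.exists_max_image (fun v => |x v| / y v) Finset.univ_nonempty
  set t := |x p| / y p with ht
  have hle : ∀ v, |x v| ≤ t * y v := fun v => (div_le_iff₀ (hy v)).1 (hp v (Finset.mem_univ v))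
  have hxp : |x p| = t * y p := by rw [ht, div_mul_cancel₀ _ (hy p).ne']
  have htpos : 0 < t := by
    obtain ⟨w, hw⟩ := Function.ne_iff.1 hx0
    have : 0 < |x w| := abs_pos.2 hw
    exact (pos_iff_pos_of_mul_pos (this.trans_le (hle w))).2 (hy w)
  have hmain : G.rho * (t * y p) ≤ r * (t * y p) := by
    calc G.rho * (t * y p) ≤ |G.rho * x p| := by
          rw [abs_mul, hxp]
          exact mul_le_mul_of_nonneg_right (le_abs_self _) (mul_pos htpos (hy p)).le
      _ = |∑ w ∈ G.neighborFinset p, x w| := by rw [hxe]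
      _ ≤ ∑ w ∈ G.neighborFinset p, |x w| := Finset.abs_sum_le_sum_abs _ _
      _ ≤ ∑ w ∈ G.neighborFinset p, t * y w := Finset.sum_le_sum fun w _ => hle w
      _ = t * ∑ w ∈ G.neighborFinset p, y w := by rw [Finset.mul_sum]
      _ ≤ t * (r * y p) := mul_le_mul_of_nonneg_left (h p) htpos.le
      _ = r * (t * y p) := by ring
  exact le_of_mul_le_mul_right hmain (mul_pos htpos (hy p))

/-- A bound for the spectral radius in terms of the quotient matrix of the graph
`K_s ∨ (K_{n-2s-1} ∪ (s+1) K_1)`. -/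
theorem SimpleGraph.rho_le_of_card_degree_le {V : Type*} [Fintype V] [DecidableEq V] [Nonempty V]
    (G : SimpleGraph V) [DecidableRel G.Adj] {s : ℕ} (hs : 2 * s + 2 ≤ Fintype.card V)
    (hP : s + 1 ≤ (Finset.univ.filter fun v => G.degree v ≤ s).card)
    (hQ : Fintype.card V ≤
      (Finset.univ.filter fun v => G.degree v + s + 2 ≤ Fintype.card V).card + s)
    {a b c r : ℝ} (hc : 0 < c) (hcb : c ≤ b) (hba : b ≤ a)
    (h₁ : s * a ≤ r * c)
    (h₂ : s * a + ((Fintype.card V : ℝ) - 2 * s - 2) * b ≤ r * b)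
    (h₃ : ((s : ℝ) - 1) * a + ((Fintype.card V : ℝ) - 2 * s - 1) * b + (s + 1) * c ≤ r * a) :
    G.rho ≤ r := by
  classical
  set n := Fintype.card V with hn
  -- Writing the weight as c plus nonnegative increments lets its sum be bounded using only the two
  -- cardinalities.
  set y : V → ℝ := fun v => c + (if G.degree v ≤ s then 0 else b - c) +
    (if G.degree v + s + 2 ≤ n then 0 else a - b) with hy
  have hyP : ∀ v, G.degree v ≤ s → y v = c := fun v h => by
    have h' : G.degree v + s + 2 ≤ n := by omega
    simp [hy, h, h']
  have hyQ : ∀ v, ¬ G.degree v ≤ s → G.degree v + s + 2 ≤ n → y v = b := fun v h h' => by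
    simp [hy, h, h']
  have hyH : ∀ v, ¬ G.degree v + s + 2 ≤ n → y v = a := fun v h' => by
    have h : ¬ G.degree v ≤ s := by omega
    simp [hy, h, h']
  have hya : ∀ v, y v ≤ a := fun v => by
    by_cases h : G.degree v ≤ s
    · rw [hyP v h]; linarith
    · by_cases h' : G.degree v + s + 2 ≤ n
      · rw [hyQ v h h']; linarith
      · rw [hyH v h']
  have hyb : ∀ v, y v ≤ b + if G.degree v + s + 2 ≤ n then 0 else a - b := fun v => by
    by_cases h : G.degree v ≤ s
    · have h' : G.degree v + s + 2 ≤ n := by omega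
      rw [hyP v h, if_pos h']; linarith
    · by_cases h' : G.degree v + s + 2 ≤ n
      · rw [hyQ v h h', if_pos h']; linarith
      · rw [hyH v h', if_neg h']; linarith
  have hPc : ((Finset.univ.filter fun v => ¬ G.degree v ≤ s).card : ℝ) ≤ n - s - 1 := by
    have := Finset.card_filter_add_card_filter_not (s := (Finset.univ : Finset V))
      (fun v => G.degree v ≤ s)
    rw [Finset.card_univ] at this
    have h2 : (Finset.univ.filter fun v => ¬ G.degree v ≤ s).card + s + 1 ≤ n := by omega
    have h3 : (((Finset.univ.filter fun v => ¬ G.degree v ≤ s).card + s + 1 : ℕ) : ℝ) ≤ n := by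
      exact_mod_cast h2
    push_cast at h3
    linarith
  have hQc : ((Finset.univ.filter fun v => ¬ G.degree v + s + 2 ≤ n).card : ℝ) ≤ s := by
    have := Finset.card_filter_add_card_filter_not (s := (Finset.univ : Finset V))
      (fun v => G.degree v + s + 2 ≤ n)
    rw [Finset.card_univ] at this
    exact_mod_cast (by omega : (Finset.univ.filter fun v => ¬ G.degree v + s + 2 ≤ n).card ≤ s)
  have hQsum : ∑ v, (if G.degree v + s + 2 ≤ n then 0 else a - b) ≤ s * (a - b) := by
    rw [Finset.sum_ite]
    simp only [Finset.sum_const_zero, zero_add, Finset.sum_const, nsmul_eq_mul]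
    exact mul_le_mul_of_nonneg_right hQc (by linarith)
  have hPsum : ∑ v, (if G.degree v ≤ s then 0 else b - c) ≤ (n - s - 1) * (b - c) := by
    rw [Finset.sum_ite]
    simp only [Finset.sum_const_zero, zero_add, Finset.sum_const, nsmul_eq_mul]
    exact mul_le_mul_of_nonneg_right hPc (by linarith)
  have hypos : ∀ v, 0 < y v := fun v => by
    by_cases h : G.degree v ≤ s
    · rw [hyP v h]; linarith
    · by_cases h' : G.degree v + s + 2 ≤ n
      · rw [hyQ v h h']; linarith
      · rw [hyH v h']; linarith
  refine G.rho_le_of_forall_sum_le hypos fun v => ?_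
  by_cases h : G.degree v ≤ s
  · calc ∑ w ∈ G.neighborFinset v, y w ≤ ∑ w ∈ G.neighborFinset v, a :=
          Finset.sum_le_sum fun w _ => hya w
      _ = G.degree v * a := by simp
      _ ≤ s * a := mul_le_mul_of_nonneg_right (by exact_mod_cast h) (by linarith)
      _ ≤ r * y v := by rw [hyP v h]; exact h₁
  · by_cases h' : G.degree v + s + 2 ≤ n
    · have hd : (G.degree v : ℝ) ≤ n - s - 2 := by
        have : ((G.degree v + s + 2 : ℕ) : ℝ) ≤ n := by exact_mod_cast h'
        push_cast at this
        linarith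
      calc ∑ w ∈ G.neighborFinset v, y w
          ≤ ∑ w ∈ G.neighborFinset v, (b + if G.degree w + s + 2 ≤ n then 0 else a - b) :=
            Finset.sum_le_sum fun w _ => hyb w
        _ = G.degree v * b +
            ∑ w ∈ G.neighborFinset v, (if G.degree w + s + 2 ≤ n then 0 else a - b) := by
            simp [Finset.sum_add_distrib]
        _ ≤ (n - s - 2) * b + s * (a - b) := by
            refine add_le_add (mul_le_mul_of_nonneg_right hd (by linarith)) (le_trans ?_ hQsum)
            refine Finset.sum_le_sum_of_subset_of_nonneg (Finset.subset_univ _) fun w _ _ => ?_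
            split_ifs <;> linarith
        _ ≤ r * y v := by rw [hyQ v h h']; linarith
    -- A high-degree vertex is treated as if adjacent to all others: its neighbour sum is at most
    -- the total weight minus a.
    · have hsub : G.neighborFinset v ⊆ Finset.univ.erase v := fun w hw => by
        rw [SimpleGraph.mem_neighborFinset] at hw
        simpa using hw.ne'
      have htot : ∑ w, y w ≤ n * c + (n - s - 1) * (b - c) + s * (a - b) := by
        simp only [hy, Finset.sum_add_distrib, Finset.sum_const, Finset.card_univ, nsmul_eq_mul]
        linarith
      have herase := Finset.add_sum_erase Finset.univ y (Finset.mem_univ v)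
      have hle := Finset.sum_le_sum_of_subset_of_nonneg (f := y) hsub fun w _ _ => (hypos w).le
      rw [hyH v h'] at herase ⊢
      linarith

/-! ### The spectral condition. -/

theorem SimpleGraph.HasHamiltonPath.of_sqrt_le_rho {V : Type*} [Fintype V] [DecidableEq V]
    {G : SimpleGraph V} [DecidableRel G.Adj] (hcard : 7 ≤ Fintype.card V) (hconn : G.Connected)
    (hrho : √(((Fintype.card V : ℝ) - 3) ^ 2 + 2) ≤ G.rho) : G.HasHamiltonPath := by
  by_contra hG
  have : Nonempty V := hconn.nonempty
  have : Nontrivial V := Fintype.one_lt_card_iff_nontrivial.1 (by omega)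
  obtain ⟨s, hs1, hs, hP, hQ⟩ := exists_card_degree_le_of_not_hasHamiltonPath hG
    fun v => hconn.preconnected.degree_pos_of_nontrivial v
  obtain ⟨N, hN⟩ : ∃ N : ℝ, N = (Fintype.card V : ℝ) - 3 := ⟨_, rfl⟩
  have hcV : (Fintype.card V : ℝ) = N + 3 := by linarith
  have hN4 : 4 ≤ N := by
    have : (7 : ℝ) ≤ Fintype.card V := by exact_mod_cast hcard
    linarith
  have hsN : 2 * (s : ℝ) ≤ N + 1 := by
    have : ((2 * s + 2 : ℕ) : ℝ) ≤ Fintype.card V := by exact_mod_cast hs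
    push_cast at this
    linarith
  rw [← hN] at hrho
  suffices h : ∃ r : ℝ, 0 ≤ r ∧ r ^ 2 < N ^ 2 + 2 ∧ G.rho ≤ r by
    obtain ⟨r, hr0, hr, hle⟩ := h
    have : r < √(N ^ 2 + 2) := Real.lt_sqrt_of_sq_lt hr
    linarith
  rcases eq_or_lt_of_le hs1 with rfl | hs2
  -- With r = N + e and e(N + 1) = 1, r² = N² + 2 - 2e + e² < N² + 2. The weights make `h₁` and `h₂`
  -- equalities.
  · obtain ⟨e, he⟩ : ∃ e : ℝ, e = 1 / (N + 1) := ⟨_, rfl⟩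
    have he0 : 0 < e := by rw [he]; positivity
    have heN : e * N = 1 - e := by rw [he]; field_simp; ring
    have he5 : e ≤ 1 / 5 := by nlinarith
    refine ⟨N + e, by linarith, by nlinarith, ?_⟩
    refine G.rho_le_of_card_degree_le hs hP hQ (a := (1 + e) * (N + e)) (b := N + e) (c := 1 + e)
      (by linarith) (by linarith) (by nlinarith) ?_ ?_ ?_
    · push_cast; nlinarith
    · rw [hcV]; push_cast; nlinarith
    · rw [hcV]; push_cast
      nlinarith [mul_nonneg he0.le he0.le]
  · have hs2' : (2 : ℝ) ≤ s := by exact_mod_cast hs2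
    -- For r = N these weights make `h₁` and `h₂` equalities, and `h₃` becomes `key`.
    refine ⟨N, by linarith, by linarith, ?_⟩
    refine G.rho_le_of_card_degree_le hs hP hQ (a := N * (2 * s - 1)) (b := s * N)
      (c := s * (2 * s - 1)) (by nlinarith) (by nlinarith) (by nlinarith) ?_ ?_ ?_
    · nlinarith
    · rw [hcV]; nlinarith
    · rw [hcV]
      -- For s = 2 this reads 18 ≤ N² + N, true for N ≥ 4 but false for N = 3, that is n = 6. For s
      -- ≥ 3 the bound N ≥ 2s - 1 suffices.
      have key : s * (s + 1) * (2 * s - 1) ≤ (s - 1) * (N ^ 2 + N) := by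
        rcases eq_or_lt_of_le (Nat.succ_le_of_lt hs2) with h2 | h3
        · have : (s : ℝ) = 2 := by rw [← h2]; norm_num
          rw [this]; nlinarith
        · have h3' : (3 : ℝ) ≤ s := by exact_mod_cast h3
          have h4 : (2 * (s : ℝ) - 1) ^ 2 + (2 * s - 1) ≤ N ^ 2 + N := by nlinarith
          have h5 : ((s : ℝ) - 1) * ((2 * s - 1) ^ 2 + (2 * s - 1)) ≤ (s - 1) * (N ^ 2 + N) :=
            mul_le_mul_of_nonneg_left h4 (by linarith)
          have h6 : 0 ≤ (s : ℝ) * (2 * s - 1) * (s - 3) :=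
            mul_nonneg (mul_nonneg (by linarith) (by linarith)) (by linarith)
          linarith
      linarith

/-! ### The graph K₂ ∨ 4K₁. -/

/-- Right entries must be separated by left ones. The second conjunct strengthens the induction for
lists starting on the left. -/
theorem List.IsChain.countP_isRight_le {V W : Type*} (l : List (V ⊕ W))
    (h : l.IsChain fun a b => ¬(a.isRight = true ∧ b.isRight = true)) :
    l.countP Sum.isRight ≤ l.countP Sum.isLeft + 1 ∧
      (∀ w t, l = Sum.inl w :: t → l.countP Sum.isRight ≤ l.countP Sum.isLeft) := by
  induction l with
  | nil => simp
  | cons x t ih =>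
    have ih := ih h.of_cons
    cases x with
    | inl v =>
      simp only [List.countP_cons, Sum.isRight_inl, Sum.isLeft_inl]
      refine ⟨?_, fun _ _ _ => ?_⟩ <;> simp <;> omega
    | inr w =>
      refine ⟨?_, by simp⟩
      cases t with
      | nil => simp
      | cons y t =>
        rw [List.isChain_cons_cons] at h
        cases y with
        | inl v =>
          have := ih.2 v t rfl
          simp only [List.countP_cons, Sum.isRight_inl, Sum.isLeft_inl, Sum.isRight_inr,
            Sum.isLeft_inr] at this ⊢
          simp at this ⊢
          omega
        | inr v => simp at h

theorem not_hasHamiltonPath_K2Join4K1 : ¬ K2Join4K1.HasHamiltonPath := by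
  intro hp
  obtain ⟨l, hl, hc⟩ := SimpleGraph.hasHamiltonPath_iff_exists_list.1 hp
  have hch : l.IsChain fun a b => ¬(a.isRight = true ∧ b.isRight = true) := by
    refine hl.imp fun a b hab => ?_
    rcases a with a | a <;> rcases b with b | b <;>
      simp_all [K2Join4K1, SimpleGraph.graphJoin]
  have h := (List.IsChain.countP_isRight_le _ hch).1
  rw [List.countP_eq_card_filter_univ hc, List.countP_eq_card_filter_univ hc] at h
  revert h
  decide

theorem connected_K2Join4K1 : K2Join4K1.Connected := by
  have h : ∀ a, K2Join4K1.Reachable (.inl 0) a := by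
    intro a
    by_cases ha : a = .inl 0
    · rw [ha]
    · refine SimpleGraph.Adj.reachable ?_
      revert a
      decide
  exact ⟨fun a b => (h a).symm.trans (h b)⟩

theorem sqrt_lt_rho_K2Join4K1 :
    √(((Fintype.card (Fin 2 ⊕ Fin 4) : ℝ) - 3) ^ 2 + 2) < K2Join4K1.rho := by
  -- The quotient matrix of the join has characteristic equation μ² = μ + 8; the eigenvector is μ on
  -- K₂ and 2 on the independent vertices.
  set μ : ℝ := (1 + √33) / 2 with hμ
  have h33 : √33 ^ 2 = 33 := Real.sq_sqrt (by norm_num)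
  have hpos : 0 ≤ √33 := Real.sqrt_nonneg _
  have hμ2 : μ * μ = μ + 8 := by rw [hμ]; nlinarith
  have hval : Module.End.HasEigenvalue (Matrix.toLin' (K2Join4K1.adjMatrix ℝ)) μ := by
    refine Module.End.hasEigenvalue_of_hasEigenvector
      (x := Sum.elim (fun _ => μ) (fun _ => 2)) ⟨?_, ?_⟩
    · rw [Module.End.mem_eigenspace_iff]
      have hll : ∀ i j : Fin 2, K2Join4K1.Adj (.inl i) (.inl j) ↔ i ≠ j := by decide
      have hlr : ∀ (i : Fin 2) (j : Fin 4), K2Join4K1.Adj (.inl i) (.inr j) := by decide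
      have hrl : ∀ (i : Fin 4) (j : Fin 2), K2Join4K1.Adj (.inr i) (.inl j) := by decide
      have hrr : ∀ i j : Fin 4, ¬ K2Join4K1.Adj (.inr i) (.inr j) := by decide
      ext i
      rw [Matrix.toLin'_apply, Matrix.mulVec, dotProduct, Fintype.sum_sum_type]
      simp only [SimpleGraph.adjMatrix_apply]
      rcases i with i | i
      · simp only [hll, hlr]
        fin_cases i <;> simp [Fin.sum_univ_succ] <;> linarith
      · simp [hrl, hrr, mul_comm]
    · intro h
      have := congrFun h (.inr 0)
      simp at this
  refine lt_of_lt_of_le ?_ (K2Join4K1.isGreatest_rho.2 hval)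
  have h5 : (5.7 : ℝ) < √33 := Real.lt_sqrt_of_sq_lt (by norm_num)
  rw [Real.sqrt_lt' (by rw [hμ]; linarith)]
  simp only [Fintype.card_sum, Fintype.card_fin]
  push_cast
  nlinarith

theorem corollary2 :
    (∀ (V : Type*) [Fintype V] [DecidableEq V] (G : SimpleGraph V) [DecidableRel G.Adj],
      7 ≤ Fintype.card V → G.Connected →
      √(((Fintype.card V : ℝ) - 3) ^ 2 + 2) ≤ G.rho → G.HasHamiltonPath) ∧
    (K2Join4K1.Connected ∧
      √(((Fintype.card (Fin 2 ⊕ Fin 4) : ℝ) - 3) ^ 2 + 2) < K2Join4K1.rho ∧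
      ¬ K2Join4K1.HasHamiltonPath) :=
  ⟨fun _ _ _ _ _ hcard hconn hrho => .of_sqrt_le_rho hcard hconn hrho,
    connected_K2Join4K1, sqrt_lt_rho_K2Join4K1, not_hasHamiltonPath_K2Join4K1⟩
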